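/- Let $\lambda_1,\lambda_2>0$ and $K\ge 4$ be real numbers. For an irrational $\beta\in[0,1]$ put $$a(n)=(\lambda_1-\lambda_2)\bigl(\lfloor (n+1)\beta\rfloor-\lfloor n\beta\rfloor\bigr)+\lambda_2\qquad(n\in\mathbb Z),$$ and let $H$ be the bounded self-adjoint operator on $\ell^2(\mathbb Z)$ given by $(H\psi)(n)=a(n)\psi(n+1)+a(n-1)\psi(n-1)$ (the off-diagonal Sturmian model). Let $(\delta_n)_{n\in\mathbb Z}$ be the canonical basis and define, for $T>0$ and $N\in\mathbb N$, $$\langle a(n,T)\rangle=\frac2T\int_0^\infty e^{-2t/T}\,\bigl|\langle e^{-itH}\delta_1,\delta_n\rangle\bigr|^2\,dt,\qquad \langle P(N,T)\rangle=\sum_{|n|>N}\langle a(n,T)\rangle .$$ For $z\in\mathbb C$ and $n\ge 1$ let $F(n,z)=T_n(z)\cdots T_1(z)$, where $$T_m(z)=\frac1{a(m)}\begin{pmatrix} z&-1\\ a(m)^2&0\end{pmatrix},$$ and let $\|\cdot\|$ be the operator norm on $2\times2$ complex matrices induced by the Euclidean norm on $\mathbb C^2$. There are constants $c>0$ and $C>0$,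 depending only on $\lambda_1,\lambda_2,K$, such that for every irrational $\beta\in[0,1]$ with $\sigma(H)\subset[-K+1,K-1]$, every integer $N\ge1$ and every real $T>0$, $$\langle P(N,T)\rangle\;\le\; C\left(e^{-cN}+T^3\int_{-K}^{K}\Bigl(\max_{1\le n\le N}\bigl\|F\bigl(n,E+\tfrac iT\bigr)\bigr\|^2\Bigr)^{-1}dE\right).$$ -/

import Mathlib

open scoped ENNReal

namespace OffDiagSturm

/-- The complex Hilbert space `ℓ²(ℤ)`. -/
abbrev ell2Z : Type := lp (fun _ : ℤ => ℂ) 2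

/-- The canonical basis vector `δ_n`. -/
noncomputable def delta (n : ℤ) : ell2Z := lp.single 2 n (1 : ℂ)

/-- The pointwise action of the Jacobi operator on sequences,
`(Hψ)(n) = a(n) ψ(n+1) + a(n-1) ψ(n-1) + b(n) ψ(n)`. -/
noncomputable def jacobiFun (a b : ℤ → ℝ) (ψ : ℤ → ℂ) (n : ℤ) : ℂ :=
  (a n : ℂ) * ψ (n + 1) + (a (n - 1) : ℂ) * ψ (n - 1) + (b n : ℂ) * ψ n

theorem memℓp_two_iff (f : ℤ → ℂ) :
    Memℓp (E := fun _ : ℤ => ℂ) f 2 ↔ Summable fun i => ‖f i‖ ^ (2 : ℕ) := by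
  rw [memℓp_gen_iff (by norm_num)]
  norm_num

theorem memℓp_shift (ψ : ell2Z) (k : ℤ) :
    Memℓp (E := fun _ : ℤ => ℂ) (fun n => ψ (n + k)) 2 := by
  rw [memℓp_two_iff]
  exact ((memℓp_two_iff _).1 (lp.memℓp ψ)).comp_injective (add_left_injective k)

theorem memℓp_bdd_mul {a : ℤ → ℝ} (ha : ∃ C, ∀ n, |a n| ≤ C) {f : ℤ → ℂ}
    (hf : Memℓp (E := fun _ : ℤ => ℂ) f 2) :
    Memℓp (E := fun _ : ℤ => ℂ) (fun n => (a n : ℂ) * f n) 2 := by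
  obtain ⟨C, hC⟩ := ha
  rw [memℓp_two_iff] at hf ⊢
  refine Summable.of_nonneg_of_le (fun _ => by positivity) (fun n => ?_) (hf.mul_left (C ^ 2))
  rw [norm_mul, mul_pow, Complex.norm_real, Real.norm_eq_abs]
  have := hC n
  gcongr

theorem jacobiFun_memℓp {a b : ℤ → ℝ} (ha : ∃ C, ∀ n, |a n| ≤ C) (hb : ∃ C, ∀ n, |b n| ≤ C)
    (ψ : ell2Z) : Memℓp (E := fun _ : ℤ => ℂ) (jacobiFun a b ψ) 2 := by
  have ha' : ∃ C, ∀ n, |a (n - 1)| ≤ C := by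
    obtain ⟨C, hC⟩ := ha
    exact ⟨C, fun n => hC _⟩
  exact ((memℓp_bdd_mul ha (memℓp_shift ψ 1)).add
    (memℓp_bdd_mul ha' (memℓp_shift ψ (-1)))).add (memℓp_bdd_mul hb (lp.memℓp ψ))

/-- The Jacobi operator as a linear map of `ℓ²(ℤ)`. -/
noncomputable def jacobiLin (a b : ℤ → ℝ) (ha : ∃ C, ∀ n, |a n| ≤ C)
    (hb : ∃ C, ∀ n, |b n| ≤ C) : ell2Z →ₗ[ℂ] ell2Z where
  toFun ψ := ⟨jacobiFun a b ψ, jacobiFun_memℓp ha hb ψ⟩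
  map_add' ψ φ := by
    ext n
    change jacobiFun a b (⇑(ψ + φ)) n = jacobiFun a b ψ n + jacobiFun a b φ n
    simp only [jacobiFun, lp.coeFn_add, Pi.add_apply]
    ring
  map_smul' c ψ := by
    ext n
    change jacobiFun a b (⇑(c • ψ)) n = c • jacobiFun a b ψ n
    simp only [jacobiFun, lp.coeFn_smul, Pi.smul_apply, smul_eq_mul]
    ring

theorem jacobiLin_continuous (a b : ℤ → ℝ) (ha : ∃ C, ∀ n, |a n| ≤ C)
    (hb : ∃ C, ∀ n, |b n| ≤ C) : Continuous (jacobiLin a b ha hb) := by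
  refine LinearMap.continuous_of_seq_closed_graph _ fun u x y hu hy => ?_
  have ev : ∀ n : ℤ, Continuous fun f : ell2Z => f n := fun n =>
    (lp.lipschitzWith_one_eval (E := fun _ : ℤ => ℂ) 2 n).continuous
  ext n
  refine tendsto_nhds_unique (((ev n).tendsto y).comp hy) ?_
  have h : Continuous fun f : ell2Z => jacobiFun a b f n := by
    unfold jacobiFun
    exact ((continuous_const.mul (ev _)).add (continuous_const.mul (ev _))).add
      (continuous_const.mul (ev _))
  exact (h.tendsto x).comp hu

/-- The bounded Jacobi operator on `ℓ²(ℤ)` with bounded real coefficients `a` (off-diagonal)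
and `b` (diagonal). -/
noncomputable def jacobi (a b : ℤ → ℝ) (ha : ∃ C, ∀ n, |a n| ≤ C)
    (hb : ∃ C, ∀ n, |b n| ≤ C) : ell2Z →L[ℂ] ell2Z :=
  ⟨jacobiLin a b ha hb, jacobiLin_continuous a b ha hb⟩

@[simp] theorem jacobi_apply (a b : ℤ → ℝ) (ha : ∃ C, ∀ n, |a n| ≤ C)
    (hb : ∃ C, ∀ n, |b n| ≤ C) (ψ : ell2Z) (n : ℤ) :
    jacobi a b ha hb ψ n =
      (a n : ℂ) * ψ (n + 1) + (a (n - 1) : ℂ) * ψ (n - 1) + (b n : ℂ) * ψ n := rfl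

/-- The Sturmian hopping sequence
`a(n) = (l₁ - l₂) (⌊(n+1)β⌋ - ⌊nβ⌋) + l₂`. -/
noncomputable def hop (l₁ l₂ β : ℝ) (n : ℤ) : ℝ :=
  (l₁ - l₂) * ((⌊((n : ℝ) + 1) * β⌋ - ⌊(n : ℝ) * β⌋ : ℤ) : ℝ) + l₂

theorem hop_bounded (l₁ l₂ β : ℝ) : ∃ C, ∀ n, |hop l₁ l₂ β n| ≤ C := by
  refine ⟨|l₁ - l₂| * (|β| + 1) + |l₂|, fun n => (abs_add_le _ _).trans ?_⟩
  rw [abs_mul]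
  gcongr
  rw [Int.cast_sub, abs_le]
  have h1 := Int.floor_le (((n : ℝ) + 1) * β)
  have h2 := Int.lt_floor_add_one (((n : ℝ) + 1) * β)
  have h3 := Int.floor_le ((n : ℝ) * β)
  have h4 := Int.lt_floor_add_one ((n : ℝ) * β)
  have h5 := neg_abs_le β
  have h6 := le_abs_self β
  constructor <;> nlinarith

/-- The off-diagonal Sturmian operator `H` (with `b = 0`). -/
noncomputable def sturmH (l₁ l₂ β : ℝ) : ell2Z →L[ℂ] ell2Z :=
  jacobi (hop l₁ l₂ β) (fun _ => 0) (hop_bounded l₁ l₂ β) ⟨0, fun _ => by simp⟩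

/-- `a(n,t) = |⟨e^{-itH} δ_1, δ_n⟩|²`, the probability to be at the site `n` at time `t`. -/
noncomputable def siteProb (H : ell2Z →L[ℂ] ell2Z) (n : ℤ) (t : ℝ) : ℝ :=
  ‖inner ℂ (NormedSpace.exp ((-(Complex.I * (t : ℂ))) • H) (delta 1)) (delta n)‖ ^ 2

/-- `⟨a(n,T)⟩ = (2/T) ∫_0^∞ e^{-2t/T} a(n,t) dt`. -/
noncomputable def avgSiteProb (H : ell2Z →L[ℂ] ell2Z) (n : ℤ) (T : ℝ) : ℝ :=
  2 / T * ∫ t in Set.Ioi (0 : ℝ), Real.exp (-2 * t / T) * siteProb H n t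

/-- The time-averaged outside probability `⟨P(N,T)⟩ = ∑_{|n| > N} ⟨a(n,T)⟩`. -/
noncomputable def avgOutsideProb (H : ell2Z →L[ℂ] ell2Z) (N : ℕ) (T : ℝ) : ℝ :=
  ∑' n : {n : ℤ // (N : ℤ) < |n|}, avgSiteProb H n T

/-- The one-step matrix `T_n(z) = (1/a(n)) (z, -1; a(n)², 0)`. -/
noncomputable def stepMatrix (a : ℤ → ℝ) (n : ℤ) (z : ℂ) : Matrix (Fin 2) (Fin 2) ℂ :=
  ((a n : ℂ)⁻¹) • !![z, -1; (a n : ℂ) ^ 2, 0]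

/-- The transfer matrix `F(n,z) = T_n(z) ⋯ T_1(z)`. -/
noncomputable def transfer (a : ℤ → ℝ) : ℕ → ℂ → Matrix (Fin 2) (Fin 2) ℂ
  | 0, _ => 1
  | n + 1, z => stepMatrix a ((n : ℤ) + 1) z * transfer a n z

/-- `‖F(n,z)‖`, the operator norm on `ℂ²` with its Euclidean norm. -/
noncomputable def transferNorm (a : ℤ → ℝ) (n : ℕ) (z : ℂ) : ℝ :=
  ‖Matrix.toEuclideanCLM (n := Fin 2) (𝕜 := ℂ) (transfer a n z)‖

/-- `max_{1 ≤ n ≤ N} ‖F(n,z)‖²`. -/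
noncomputable def maxTransferSq (a : ℤ → ℝ) (N : ℕ) (hN : 1 ≤ N) (z : ℂ) : ℝ :=
  (Finset.Icc 1 N).sup' (Finset.nonempty_Icc.2 hN) fun n => transferNorm a n z ^ 2

/-! The integrals and the sum above converge. -/

theorem jacobi_isSelfAdjoint (a b : ℤ → ℝ) (ha : ∃ C, ∀ n, |a n| ≤ C)
    (hb : ∃ C, ∀ n, |b n| ≤ C) : IsSelfAdjoint (jacobi a b ha hb) := by
  rw [ContinuousLinearMap.isSelfAdjoint_iff_isSymmetric]
  intro x y
  have summ : ∀ {f g : ℤ → ℂ}, Memℓp (E := fun _ : ℤ => ℂ) f 2 →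
      Memℓp (E := fun _ : ℤ => ℂ) g 2 → Summable fun i => g i * (starRingEnd ℂ) (f i) := by
    intro f g hf hg
    exact lp.summable_inner (𝕜 := ℂ) (⟨f, hf⟩ : ell2Z) (⟨g, hg⟩ : ell2Z)
  have ha' : ∃ C, ∀ n, |a (n - 1)| ≤ C := by
    obtain ⟨C, hC⟩ := ha
    exact ⟨C, fun n => hC _⟩
  have s1 := summ (memℓp_bdd_mul ha (memℓp_shift x 1)) (lp.memℓp y)
  have s2 := summ (memℓp_bdd_mul ha' (memℓp_shift x (-1))) (lp.memℓp y)
  have s3 := summ (memℓp_bdd_mul hb (lp.memℓp x)) (lp.memℓp y)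
  have t1 := summ (lp.memℓp x) (memℓp_bdd_mul ha (memℓp_shift y 1))
  have t2 := summ (lp.memℓp x) (memℓp_bdd_mul ha' (memℓp_shift y (-1)))
  have t3 := summ (lp.memℓp x) (memℓp_bdd_mul hb (lp.memℓp y))
  have e1 := (Equiv.addRight (1 : ℤ)).tsum_eq
    fun i => ((a (i - 1) : ℂ) * y (i + -1)) * (starRingEnd ℂ) (x i)
  have e2 := (Equiv.addRight (1 : ℤ)).tsum_eq
    fun i => y i * (starRingEnd ℂ) ((a (i - 1) : ℂ) * x (i + -1))
  change inner ℂ (jacobi a b ha hb x) y = inner ℂ x (jacobi a b ha hb y)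
  rw [lp.inner_eq_tsum, lp.inner_eq_tsum]
  calc ∑' i, inner ℂ (jacobi a b ha hb x i) (y i)
      = ∑' i, ((y i * (starRingEnd ℂ) ((a i : ℂ) * x (i + 1)) +
          y i * (starRingEnd ℂ) ((a (i - 1) : ℂ) * x (i + -1))) +
          y i * (starRingEnd ℂ) ((b i : ℂ) * x i)) := by
        refine tsum_congr fun i => ?_
        simp only [jacobi_apply, RCLike.inner_apply, map_add, ← sub_eq_add_neg]
        ring
    _ = ∑' i, ((((a i : ℂ) * y (i + 1)) * (starRingEnd ℂ) (x i) +
          ((a (i - 1) : ℂ) * y (i + -1)) * (starRingEnd ℂ) (x i)) +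
          ((b i : ℂ) * y i) * (starRingEnd ℂ) (x i)) := by
        rw [(s1.add s2).tsum_add s3, s1.tsum_add s2, (t1.add t2).tsum_add t3, t1.tsum_add t2,
          ← e1, ← e2, add_comm (∑' i, y i * (starRingEnd ℂ) ((a i : ℂ) * x (i + 1)))]
        congr 1
        · congr 1
          · refine tsum_congr fun i => ?_
            simp only [Equiv.coe_addRight, add_sub_cancel_right, add_neg_cancel_right, map_mul,
              Complex.conj_ofReal]
            ring
          · refine tsum_congr fun i => ?_
            simp only [Equiv.coe_addRight, add_sub_cancel_right, add_neg_cancel_right, map_mul,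
              Complex.conj_ofReal]
            ring
        · refine tsum_congr fun i => ?_
          simp only [map_mul, Complex.conj_ofReal]
          ring
    _ = ∑' i, inner ℂ (x i) (jacobi a b ha hb y i) := by
        refine tsum_congr fun i => ?_
        simp only [jacobi_apply, RCLike.inner_apply, ← sub_eq_add_neg]
        ring

theorem sturmH_isSelfAdjoint (l₁ l₂ β : ℝ) : IsSelfAdjoint (sturmH l₁ l₂ β) :=
  jacobi_isSelfAdjoint _ _ _ _

theorem siteProb_continuous (H : ell2Z →L[ℂ] ell2Z) (n : ℤ) : Continuous (siteProb H n) := by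
  unfold siteProb
  let _ : NormedAlgebra ℚ (ell2Z →L[ℂ] ell2Z) := NormedAlgebra.restrictScalars ℚ ℂ _
  have h : Continuous fun t : ℝ => NormedSpace.exp ((-(Complex.I * (t : ℂ))) • H) :=
    NormedSpace.exp_continuous.comp (by fun_prop)
  have h2 : Continuous fun t : ℝ =>
      NormedSpace.exp ((-(Complex.I * (t : ℂ))) • H) (delta 1) := h.clm_apply continuous_const
  exact ((h2.inner continuous_const).norm).pow 2

theorem siteProb_eq (H : ell2Z →L[ℂ] ell2Z) (n : ℤ) (t : ℝ) : siteProb H n t =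
    ‖(NormedSpace.exp ((-(Complex.I * (t : ℂ))) • H) (delta 1) : ell2Z) n‖ ^ 2 := by
  unfold siteProb
  rw [delta, delta, lp.inner_single_right]
  simp

theorem siteProb_hasSum {H : ell2Z →L[ℂ] ell2Z} (hH : IsSelfAdjoint H) (t : ℝ) :
    HasSum (fun n => siteProb H n t) 1 := by
  have hmem : NormedSpace.exp ((-(Complex.I * (t : ℂ))) • H) ∈ unitary (ell2Z →L[ℂ] ell2Z) := by
    let _ : NormedAlgebra ℚ (ell2Z →L[ℂ] ell2Z) := NormedAlgebra.restrictScalars ℚ ℂ _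
    refine NormedSpace.exp_mem_unitary_of_mem_skewAdjoint ?_
    exact hH.smul_mem_skewAdjoint (by simp [skewAdjoint.mem_iff])
  have hn : ‖NormedSpace.exp ((-(Complex.I * (t : ℂ))) • H) (delta 1)‖ = 1 := by
    rw [ContinuousLinearMap.norm_map_of_mem_unitary hmem, delta, lp.norm_single (by norm_num)]
    simp
  have h := lp.hasSum_norm (by norm_num : 0 < (2 : ℝ≥0∞).toReal)
    (NormedSpace.exp ((-(Complex.I * (t : ℂ))) • H) (delta 1))
  rw [hn] at h
  simp only [siteProb_eq]
  simpa using h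

theorem siteProb_integrableOn {H : ell2Z →L[ℂ] ell2Z} (hH : IsSelfAdjoint H) (n : ℤ) {T : ℝ}
    (hT : 0 < T) : MeasureTheory.IntegrableOn
      (fun t => Real.exp (-2 * t / T) * siteProb H n t) (Set.Ioi 0) := by
  have h0 : MeasureTheory.IntegrableOn (fun t => Real.exp (-(2 / T) * t)) (Set.Ioi (0 : ℝ)) :=
    exp_neg_integrableOn_Ioi 0 (by positivity)
  have hc := siteProb_continuous H n
  refine MeasureTheory.Integrable.mono' h0
    (Continuous.aestronglyMeasurable (by fun_prop)) (Filter.Eventually.of_forall fun t => ?_)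
  have h1 : siteProb H n t ≤ 1 :=
    le_hasSum (siteProb_hasSum hH t) n fun m _ => by unfold siteProb; positivity
  have h2 : 0 ≤ siteProb H n t := by unfold siteProb; positivity
  rw [Real.norm_eq_abs, abs_of_nonneg (by positivity), show -2 * t / T = -(2 / T) * t by ring]
  exact mul_le_of_le_one_right (by positivity) h1

theorem avgSiteProb_summable {H : ell2Z →L[ℂ] ell2Z} (hH : IsSelfAdjoint H) {T : ℝ}
    (hT : 0 < T) : Summable fun n => avgSiteProb H n T := by
  have h0 : MeasureTheory.IntegrableOn (fun t => Real.exp (-2 * t / T)) (Set.Ioi (0 : ℝ)) := by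
    have := exp_neg_integrableOn_Ioi 0 (show 0 < 2 / T by positivity)
    refine this.congr_fun (fun t _ => ?_) measurableSet_Ioi
    change Real.exp (-(2 / T) * t) = Real.exp (-2 * t / T)
    congr 1
    ring
  have hp : ∀ n t, 0 ≤ siteProb H n t := fun n t => by unfold siteProb; positivity
  refine Summable.mul_left _ (summable_of_sum_le
    (c := ∫ t in Set.Ioi (0 : ℝ), Real.exp (-2 * t / T))
    (fun n => MeasureTheory.integral_nonneg fun t => mul_nonneg (Real.exp_pos _).le (hp n t))
    fun s => ?_)
  rw [← MeasureTheory.integral_finsetSum _ fun n _ => siteProb_integrableOn hH n hT]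
  refine MeasureTheory.integral_mono
    (MeasureTheory.integrable_finsetSum _ fun n _ => siteProb_integrableOn hH n hT) h0 fun t => ?_
  simp only [← Finset.mul_sum]
  exact mul_le_of_le_one_right (Real.exp_pos _).le
    (sum_le_hasSum s (fun n _ => hp n t) (siteProb_hasSum hH t))

end OffDiagSturm

/-!
Parseval applied to `t ↦ e^{-t/T} e^{-itH} δ₁`, whose Fourier transform is, up to a unimodular
factor, the resolvent orbit `E ↦ (E + i/T - H)⁻¹ δ₁`, turns the time-averaged probability of
`|n| > N` into `1 / (πT)` times the integral over `E` of the mass of `u = (z - H)⁻¹ δ₁` outside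
`[-N, N]`, where `z = E + i/T`.

If `|z| ≥ K > ‖H‖`, note that `H^N u = z^N u` at the sites `|n| > N`, because `H` moves mass by one
site only. So the mass of `u` there is at most `(‖H‖ / |z|)^(2N) ‖u‖²`: it decays exponentially in
`N`, and `‖u‖²` is of order `|z|⁻²`, which is integrable in `E`.

Otherwise `|E| ≤ K`. On the right half-line `u` is an `ℓ²` solution of `Hu = zu`, so its current
through the bond at `m` is `Im z` times the mass `X` of `u` beyond `m`. A solution `P` with real
initial data has current of the opposite sign, and the constancy of the Wronskian `W` of `u` and
`P` yields `Im z * X * |P(m)|² ≤ |W| |P(m)| |u(m+1)|`. Since `|u(m+1)|² ≤ X`, it follows that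
`X * |P(m)|² ≤ |W|² / (Im z)²`, and the two columns of the transfer matrix are such `P`. As `β` is
irrational, `n ↦ -n - 1` preserves the hopping coefficients away from the origin, so the left
half-line obeys the same recurrence and the same bound.
-/

namespace OffDiagSturm

open MeasureTheory FourierTransform Filter Topology Complex ComplexConjugate

section Plancherel

variable {V F : Type*} [NormedAddCommGroup V] [InnerProductSpace ℝ V] [FiniteDimensional ℝ V]
  [MeasurableSpace V] [BorelSpace V] [NormedAddCommGroup F] [InnerProductSpace ℂ F]

theorem norm_toLp_two_sq {X : Type*} [MeasurableSpace X] {μ : Measure X} {h : X → F}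
    (hh : MemLp h 2 μ) : ‖hh.toLp h‖ ^ 2 = ∫ x, ‖h x‖ ^ 2 ∂μ := by
  have hint := L2.integrable_inner (𝕜 := ℂ) (hh.toLp h) (hh.toLp h)
  rw [← inner_self_eq_norm_sq (𝕜 := ℂ), L2.inner_def, ← integral_re hint]
  refine integral_congr_ae ?_
  filter_upwards [hh.coeFn_toLp] with x hx
  rw [hx, inner_self_eq_norm_sq]

variable [CompleteSpace F] {f : V → F}

theorem fourier_toLp_ae_eq (hf : Integrable f) (hf₂ : MemLp f 2) :
    (𝓕 (hf₂.toLp f) : Lp F 2 (volume : Measure V)) =ᵐ[volume] 𝓕 f := by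
  have hcont : Continuous (𝓕 f) :=
    VectorFourier.fourierIntegral_continuous Real.continuous_fourierChar
      (by exact continuous_inner) hf
  refine ae_eq_of_integral_contDiff_smul_eq ((Lp.memLp _).locallyIntegrable (by norm_num))
    hcont.locallyIntegrable fun g hg hgc => ?_
  have hφc : HasCompactSupport (Complex.ofRealCLM ∘ g) := hgc.comp_left rfl
  set φ := hφc.toSchwartzMap (Complex.ofRealCLM.contDiff.comp hg) with hφ
  have smul_eq : ∀ h : V → F, ∫ x, g x • h x = ∫ x, φ x • h x := fun h => by simp [hφ]
  calc ∫ x, g x • (𝓕 (hf₂.toLp f) : Lp F 2 (volume : Measure V)) x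
      = Lp.toTemperedDistribution (𝓕 (hf₂.toLp f)) φ := by
        rw [smul_eq, Lp.toTemperedDistribution_apply]
    _ = ∫ x, (𝓕 φ) x • (hf₂.toLp f) x := by
        rw [← Lp.fourier_toTemperedDistribution_eq, TemperedDistribution.fourier_apply,
          Lp.toTemperedDistribution_apply]
    _ = ∫ x, (𝓕 (φ : V → ℂ)) x • f x := by
        refine integral_congr_ae ?_
        filter_upwards [hf₂.coeFn_toLp] with x hx
        rw [hx, SchwartzMap.fourier_coe]
    _ = ∫ x, φ x • 𝓕 f x := by
        simpa using! (VectorFourier.integral_fourierIntegral_smul_eq_flip (L := innerₗ V)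
          Real.continuous_fourierChar continuous_inner φ.integrable hf)
    _ = ∫ x, g x • 𝓕 f x := (smul_eq _).symm

theorem memLp_two_fourier (hf : Integrable f) (hf₂ : MemLp f 2) : MemLp (𝓕 f) 2 :=
  (memLp_congr_ae (fourier_toLp_ae_eq hf hf₂)).1 (Lp.memLp _)

theorem integral_norm_sq_fourier (hf : Integrable f) (hf₂ : MemLp f 2) :
    ∫ ξ, ‖𝓕 f ξ‖ ^ 2 = ∫ x, ‖f x‖ ^ 2 := by
  have h𝓕 : 𝓕 (hf₂.toLp f) = (memLp_two_fourier hf hf₂).toLp (𝓕 f) :=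
    Lp.ext ((fourier_toLp_ae_eq hf hf₂).trans (MemLp.coeFn_toLp _).symm)
  rw [← norm_toLp_two_sq (memLp_two_fourier hf hf₂), ← norm_toLp_two_sq hf₂, ← h𝓕,
    Lp.norm_fourier_eq]

end Plancherel

section SelfAdjoint

variable {E : Type*} [NormedAddCommGroup E] [InnerProductSpace ℂ E]

theorem inner_apply_sub_im {H : E →ₗ[ℂ] E} (hH : H.IsSymmetric) (z : ℂ) (x : E) :
    (inner ℂ x (z • x - H x)).im = z.im * ‖x‖ ^ 2 := by
  have hreal : (inner ℂ x (H x)).im = 0 := hH.im_inner_self_apply x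
  rw [inner_sub_right, inner_smul_right, inner_self_eq_norm_sq_to_K, sub_im, hreal]
  simp [← ofReal_pow]

theorem im_mul_norm_le {H : E →ₗ[ℂ] E} (hH : H.IsSymmetric) (z : ℂ) (x : E) :
    z.im * ‖x‖ ≤ ‖z • x - H x‖ := by
  rcases (norm_nonneg x).eq_or_lt with hx | hx
  · simp [← hx]
  · refine le_of_mul_le_mul_left ?_ hx
    calc ‖x‖ * (z.im * ‖x‖) = (inner ℂ x (z • x - H x)).im := by
          rw [inner_apply_sub_im hH]; ring
      _ ≤ ‖x‖ * ‖z • x - H x‖ := (im_le_norm _).trans (norm_inner_le_norm _ _)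

variable [CompleteSpace E] {H : E →L[ℂ] E}

theorem isUnit_algebraMap_sub (hH : IsSelfAdjoint H) {z : ℂ} (hz : z.im ≠ 0) :
    IsUnit (algebraMap ℂ (E →L[ℂ] E) z - H) := by
  by_contra h
  exact hz (hH.im_eq_zero_of_mem_spectrum (spectrum.mem_iff.2 h))

theorem smul_resolvent_sub_apply_resolvent (hH : IsSelfAdjoint H) {z : ℂ} (hz : z.im ≠ 0) (x : E) :
    z • resolvent H z x - H (resolvent H z x) = x := by
  have h := congrArg (· x) (Ring.mul_inverse_cancel _ (isUnit_algebraMap_sub hH hz))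
  simpa [resolvent, Algebra.algebraMap_eq_smul_one] using h

theorem smul_resolvent_sub_resolvent_apply (hH : IsSelfAdjoint H) {z : ℂ} (hz : z.im ≠ 0) (x : E) :
    z • resolvent H z x - resolvent H z (H x) = x := by
  have h := congrArg (· x) (Ring.inverse_mul_cancel _ (isUnit_algebraMap_sub hH hz))
  simpa [resolvent, Algebra.algebraMap_eq_smul_one] using h

theorem norm_resolvent_apply_le (hH : IsSelfAdjoint H) {z : ℂ} (hz : 0 < z.im) (x : E) :
    ‖resolvent H z x‖ ≤ ‖x‖ / z.im := by
  rw [le_div_iff₀' hz]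
  simpa [smul_resolvent_sub_apply_resolvent hH hz.ne'] using
    im_mul_norm_le (ContinuousLinearMap.isSelfAdjoint_iff_isSymmetric.1 hH) z (resolvent H z x)

theorem norm_resolvent_apply_le_of_norm_lt (hH : IsSelfAdjoint H) {z : ℂ} (hz : z.im ≠ 0)
    (hHz : ‖H‖ < ‖z‖) (x : E) : ‖resolvent H z x‖ ≤ ‖x‖ / (‖z‖ - ‖H‖) := by
  rw [le_div_iff₀' (sub_pos.2 hHz), sub_mul, sub_le_iff_le_add]
  set u := resolvent H z x
  calc ‖z‖ * ‖u‖ = ‖(z • u - H u) + H u‖ := by rw [sub_add_cancel, norm_smul]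
    _ ≤ ‖z • u - H u‖ + ‖H u‖ := norm_add_le _ _
    _ ≤ ‖x‖ + ‖H‖ * ‖u‖ := by
      rw [smul_resolvent_sub_apply_resolvent hH hz]
      gcongr
      exact H.le_opNorm u

theorem norm_le_of_spectrum_subset_Icc {A : Type*} [CStarAlgebra A] {a : A} (ha : IsSelfAdjoint a)
    {r : ℝ} (hr : 0 ≤ r) (h : spectrum ℂ a ⊆ ofReal '' Set.Icc (-r) r) : ‖a‖ ≤ r := by
  have hrad : spectralRadius ℂ a ≤ ENNReal.ofReal r := by
    refine iSup₂_le fun k hk => ?_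
    obtain ⟨x, hx, rfl⟩ := h hk
    rw [← enorm_eq_nnnorm, ← ofReal_norm]
    refine ENNReal.ofReal_le_ofReal ?_
    rwa [norm_real, Real.norm_eq_abs, abs_le]
  rwa [ha.spectralRadius_eq_nnnorm, ← enorm_eq_nnnorm, ← ofReal_norm,
    ENNReal.ofReal_le_ofReal_iff hr] at hrad

end SelfAdjoint

section Propagator

variable {E F : Type*} [NormedAddCommGroup E] [InnerProductSpace ℂ E] [CompleteSpace E]
  [NormedAddCommGroup F] [InnerProductSpace ℂ F] {H : E →L[ℂ] E}

/-- The unitary group `e^{-itH}` generated by a bounded operator `H`. -/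
noncomputable def propagator (H : E →L[ℂ] E) (t : ℝ) : E →L[ℂ] E :=
  NormedSpace.exp ((-(I * (t : ℂ))) • H)

theorem propagator_zero (H : E →L[ℂ] E) : propagator H 0 = 1 := by
  simp [propagator, NormedSpace.exp_zero]

theorem norm_propagator_apply (hH : IsSelfAdjoint H) (t : ℝ) (x : E) :
    ‖propagator H t x‖ = ‖x‖ := by
  have hmem : propagator H t ∈ unitary (E →L[ℂ] E) := by
    let _ : NormedAlgebra ℚ (E →L[ℂ] E) := NormedAlgebra.restrictScalars ℚ ℂ _
    refine NormedSpace.exp_mem_unitary_of_mem_skewAdjoint ?_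
    exact hH.smul_mem_skewAdjoint (by simp [skewAdjoint.mem_iff])
  exact ContinuousLinearMap.norm_map_of_mem_unitary hmem x

theorem hasDerivAt_propagator_apply (H : E →L[ℂ] E) (x : E) (t : ℝ) :
    HasDerivAt (fun t => propagator H t x) (-I • H (propagator H t x)) t := by
  have hexp : ∀ t : ℝ, propagator H t = NormedSpace.exp (t • (-I • H)) := fun t => by
    rw [propagator, ← Complex.coe_smul, smul_smul, mul_neg, mul_comm]
  have h := hasDerivAt_exp_smul_const' (𝕂 := ℝ) (-I • H) t
  simp only [hexp]
  convert! ((ContinuousLinearMap.apply ℂ E x).restrictScalars ℝ).hasFDerivAt.comp_hasDerivAt t h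
    using 1

theorem continuous_propagator_apply (H : E →L[ℂ] E) (x : E) :
    Continuous fun t => propagator H t x :=
  continuous_iff_continuousAt.2 fun t => (hasDerivAt_propagator_apply H x t).continuousAt

theorem norm_cexp_I_mul_smul_propagator (hH : IsSelfAdjoint H) (z : ℂ) (t : ℝ) (x : E) :
    ‖cexp (I * z * t) • propagator H t x‖ = Real.exp (-z.im * t) * ‖x‖ := by
  rw [norm_smul, norm_propagator_apply hH, norm_exp]
  simp

theorem integrableOn_cexp_smul_propagator (hH : IsSelfAdjoint H) {z : ℂ} (hz : 0 < z.im) (x : E) :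
    IntegrableOn (fun t : ℝ => cexp (I * z * t) • propagator H t x) (Set.Ioi 0) := by
  have := continuous_propagator_apply H x
  refine ((exp_neg_integrableOn_Ioi 0 hz).mul_const ‖x‖).mono'
    (Continuous.aestronglyMeasurable (by fun_prop)) (.of_forall fun t => ?_)
  exact (norm_cexp_I_mul_smul_propagator hH z t x).le

theorem hasDerivAt_cexp_smul_propagator (H : E →L[ℂ] E) (z : ℂ) (x : E) (t : ℝ) :
    HasDerivAt (fun t : ℝ => cexp (I * z * t) • propagator H t x)
      (I • cexp (I * z * t) • (z • propagator H t x - H (propagator H t x))) t := by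
  have hexp : HasDerivAt (fun t : ℝ => cexp (I * z * t)) (cexp (I * z * t) * (I * z)) t := by
    simpa using ((hasDerivAt_id (t : ℂ)).const_mul (I * z)).cexp.comp_ofReal
  convert! hexp.smul (hasDerivAt_propagator_apply H x t) using 1
  module

theorem integral_cexp_smul_propagator (hH : IsSelfAdjoint H) {z : ℂ} (hz : 0 < z.im) (x : E) :
    ∫ t in Set.Ioi (0 : ℝ), cexp (I * z * t) • propagator H t x = I • resolvent H z x := by
  -- `e^{izt} e^{-itH} x` has the primitive `-i R(z) e^{izt} e^{-itH} x`.
  set A : E →L[ℂ] E := -I • resolvent H z with hA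
  have hA_apply : ∀ (c : ℂ) (y : E), A (I • c • (z • y - H y)) = c • y := fun c y => by
    conv_rhs => rw [← smul_resolvent_sub_resolvent_apply hH hz.ne' y]
    rw [hA, smul_apply, map_smul, map_smul, map_sub, map_smul, smul_smul]
    simp
  have hderiv : ∀ t ∈ Set.Ici (0 : ℝ), HasDerivAt
      (fun t : ℝ => A (cexp (I * z * t) • propagator H t x))
      (cexp (I * z * t) • propagator H t x) t := fun t _ => by
    rw [← hA_apply]
    exact (A.restrictScalars ℝ).hasFDerivAt.comp_hasDerivAt t
      (hasDerivAt_cexp_smul_propagator H z x t)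
  have hlim : Tendsto (fun t : ℝ => A (cexp (I * z * t) • propagator H t x)) atTop (𝓝 0) := by
    rw [← map_zero A]
    refine (A.continuous.tendsto 0).comp (tendsto_zero_iff_norm_tendsto_zero.2 ?_)
    simp only [norm_cexp_I_mul_smul_propagator hH]
    simpa using (Real.tendsto_exp_atBot.comp
      (tendsto_id.const_mul_atTop_of_neg (neg_lt_zero.2 hz))).mul_const ‖x‖
  rw [integral_Ioi_of_hasDerivAt_of_tendsto' hderiv
    (integrableOn_cexp_smul_propagator hH hz x) hlim]
  simp [propagator_zero, hA]

/-- The orbit `e^{-εt} e^{-itH} x` for `t > 0`, extended by zero to negative times; its Fourier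
transform is the resolvent along the line `Im z = ε`. -/
noncomputable def dampedOrbit (H : E →L[ℂ] E) (x : E) (ε : ℝ) : ℝ → E :=
  (Set.Ioi 0).indicator fun t => cexp (I * (ε * I) * t) • propagator H t x

theorem integrable_dampedOrbit (hH : IsSelfAdjoint H) (x : E) {ε : ℝ} (hε : 0 < ε) :
    Integrable (dampedOrbit H x ε) :=
  (integrableOn_cexp_smul_propagator hH (z := ε * I) (by simpa) x).integrable_indicator
    measurableSet_Ioi

theorem norm_apply_dampedOrbit_sq (A : E →L[ℂ] F) (H : E →L[ℂ] E) (x : E) (ε t : ℝ) :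
    ‖A (dampedOrbit H x ε t)‖ ^ 2 = (Set.Ioi (0 : ℝ)).indicator
      (fun t => Real.exp (-2 * ε * t) * ‖A (propagator H t x)‖ ^ 2) t := by
  by_cases ht : t ∈ Set.Ioi (0 : ℝ)
  · rw [dampedOrbit, Set.indicator_of_mem ht, Set.indicator_of_mem ht, map_smul, norm_smul,
      mul_pow, norm_exp, ← Real.exp_nat_mul]
    congr 2
    simp
    ring
  · simp [dampedOrbit, Set.indicator_of_notMem ht]

theorem memLp_two_dampedOrbit (hH : IsSelfAdjoint H) (x : E) {ε : ℝ} (hε : 0 < ε) :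
    MemLp (dampedOrbit H x ε) 2 := by
  rw [memLp_two_iff_integrable_sq_norm (integrable_dampedOrbit hH x hε).aestronglyMeasurable]
  have h := norm_apply_dampedOrbit_sq (.id ℂ E) H x ε
  simp only [ContinuousLinearMap.id_apply, norm_propagator_apply hH] at h
  simp only [h]
  refine IntegrableOn.integrable_indicator ?_ measurableSet_Ioi
  simpa only [neg_mul] using! (exp_neg_integrableOn_Ioi 0 (mul_pos two_pos hε)).mul_const (‖x‖ ^ 2)

theorem fourier_dampedOrbit (hH : IsSelfAdjoint H) (x : E) {ε : ℝ} (hε : 0 < ε) (ξ : ℝ) :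
    𝓕 (dampedOrbit H x ε) ξ = I • resolvent H ((-2 * Real.pi * ξ : ℝ) + ε * I) x := by
  rw [← integral_cexp_smul_propagator hH (by simpa) x, Real.fourier_real_eq_integral_exp_smul,
    ← integral_indicator measurableSet_Ioi]
  congr 1 with t
  by_cases ht : t ∈ Set.Ioi (0 : ℝ)
  · simp only [dampedOrbit, Set.indicator_of_mem ht, smul_smul, ← Complex.exp_add]
    congr 2
    push_cast
    ring
  · simp [dampedOrbit, Set.indicator_of_notMem ht]

variable [CompleteSpace F]

theorem norm_fourier_apply_dampedOrbit (A : E →L[ℂ] F) (hH : IsSelfAdjoint H) (x : E) {ε : ℝ}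
    (hε : 0 < ε) (ξ : ℝ) : ‖𝓕 (fun t => A (dampedOrbit H x ε t)) ξ‖ =
      ‖A (resolvent H ((-2 * Real.pi * ξ : ℝ) + ε * I) x)‖ := by
  have hA : 𝓕 (fun t => A (dampedOrbit H x ε t)) ξ = A (𝓕 (dampedOrbit H x ε) ξ) := by
    simp only [Real.fourier_eq, Circle.smul_def, ← map_smul]
    exact A.integral_comp_comm
      ((Real.fourierIntegral_convergent_iff ξ).2 (integrable_dampedOrbit hH x hε))
  rw [hA, fourier_dampedOrbit hH x hε, map_smul, norm_smul, norm_I, one_mul]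

theorem integrable_norm_apply_resolvent_sq (A : E →L[ℂ] F) (hH : IsSelfAdjoint H) (x : E) {ε : ℝ}
    (hε : 0 < ε) : Integrable fun e : ℝ => ‖A (resolvent H (e + ε * I) x)‖ ^ 2 := by
  have h := (memLp_two_fourier (A.integrable_comp (integrable_dampedOrbit hH x hε))
    ((memLp_two_dampedOrbit hH x hε).continuousLinearMap_comp A)).integrable_norm_pow two_ne_zero
  simp only [norm_fourier_apply_dampedOrbit A hH x hε] at h
  exact (integrable_comp_mul_left_iff _ (by simp [Real.pi_ne_zero])).1 h

theorem integral_norm_apply_propagator_sq (A : E →L[ℂ] F) (hH : IsSelfAdjoint H) (x : E) {ε : ℝ}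
    (hε : 0 < ε) : ∫ t in Set.Ioi (0 : ℝ), Real.exp (-2 * ε * t) * ‖A (propagator H t x)‖ ^ 2 =
      (2 * Real.pi)⁻¹ * ∫ e : ℝ, ‖A (resolvent H (e + ε * I) x)‖ ^ 2 := by
  have h := integral_norm_sq_fourier (A.integrable_comp (integrable_dampedOrbit hH x hε))
    ((memLp_two_dampedOrbit hH x hε).continuousLinearMap_comp A)
  simp only [norm_fourier_apply_dampedOrbit A hH x hε, norm_apply_dampedOrbit_sq,
    integral_indicator measurableSet_Ioi] at h
  rw [← h, Measure.integral_comp_mul_left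
    (fun e : ℝ => ‖A (resolvent H (e + ε * I) x)‖ ^ 2) (-2 * Real.pi), smul_eq_mul, neg_mul,
    inv_neg, abs_neg, abs_of_pos (by positivity)]

end Propagator

section HalfLine

/-- The pair `(p n, q n) = (w (n + 1), a n * w n)` attached to a solution `w` of the half-line
difference equation at energy `z`; `a n` is the amplitude between the sites `n + 1` and `n + 2`.
In these variables one step of the equation is the action of one transfer matrix. -/
def IsSolution (a : ℕ → ℝ) (z : ℂ) (p q : ℕ → ℂ) : Prop :=
  ∀ n, q (n + 1) = a n * p n ∧ (a n : ℂ) * p (n + 1) + q n = z * p n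

variable {a : ℕ → ℝ} {z : ℂ} {p q P Q : ℕ → ℂ}

theorem IsSolution.shift (h : IsSolution a z p q) (n : ℕ) :
    IsSolution (fun k => a (k + n)) z (fun k => p (k + n)) (fun k => q (k + n)) := fun k => by
  simpa only [add_right_comm] using h (k + n)

theorem IsSolution.wronskian_eq (h : IsSolution a z p q) (H : IsSolution a z P Q) (n : ℕ) :
    P n * q n - Q n * p n = P 0 * q 0 - Q 0 * p 0 := by
  induction n with
  | zero => rfl
  | succ n ih =>
    rw [← ih, (h n).1, (H n).1]
    linear_combination p n * (H n).2 - P n * (h n).2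

theorem IsSolution.current_succ (h : IsSolution a z p q) (n : ℕ) :
    (q n * conj (p n)).im = (q (n + 1) * conj (p (n + 1))).im + z.im * ‖p n‖ ^ 2 := by
  have hq : q n = z * p n - a n * p (n + 1) := by linear_combination (h n).2
  rw [hq, (h n).1, ← normSq_eq_norm_sq, normSq_apply]
  simp only [mul_im, sub_re, sub_im, mul_re, ofReal_re, ofReal_im, conj_re, conj_im]
  ring

theorem IsSolution.current_eq_sum (h : IsSolution a z p q) (n : ℕ) :
    (q 0 * conj (p 0)).im =
      (q n * conj (p n)).im + z.im * ∑ k ∈ Finset.range n, ‖p k‖ ^ 2 := by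
  induction n with
  | zero => simp
  | succ n ih =>
    rw [ih, h.current_succ n, Finset.sum_range_succ]
    ring

theorem IsSolution.tendsto_current (h : IsSolution a z p q) {L : ℝ} (ha : ∀ n, |a n| ≤ L)
    (hp : Summable fun k => ‖p k‖ ^ 2) :
    Tendsto (fun k => (q k * conj (p k)).im) atTop (𝓝 0) := by
  have hp₀ : Tendsto (fun k => ‖p k‖) atTop (𝓝 0) := by simpa using hp.tendsto_atTop_zero.sqrt
  have hbound : Tendsto (fun k => L * (‖p k‖ * ‖p (k + 1)‖)) atTop (𝓝 0) := by
    simpa using (hp₀.mul (hp₀.comp (tendsto_add_atTop_nat 1))).const_mul L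
  refine (tendsto_add_atTop_iff_nat 1).1 (squeeze_zero_norm (fun k => ?_) hbound)
  refine (abs_im_le_norm _).trans ?_
  rw [(h k).1, norm_mul, norm_mul, norm_real, RCLike.norm_conj, mul_assoc]
  exact mul_le_mul_of_nonneg_right (ha k) (by positivity)

theorem IsSolution.current_eq_tsum (h : IsSolution a z p q) {L : ℝ} (ha : ∀ n, |a n| ≤ L)
    (hp : Summable fun k => ‖p k‖ ^ 2) :
    (q 0 * conj (p 0)).im = z.im * ∑' k, ‖p k‖ ^ 2 := by
  have hlim := (h.tendsto_current ha hp).add (hp.hasSum.tendsto_sum_nat.const_mul z.im)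
  rw [zero_add] at hlim
  exact tendsto_nhds_unique (tendsto_const_nhds.congr h.current_eq_sum) hlim

theorem im_current_mul_norm_sq_sub_le (x y X Y : ℂ) :
    ‖X‖ ^ 2 * (y * conj x).im - ‖x‖ ^ 2 * (Y * conj X).im ≤ ‖X * y - Y * x‖ * (‖X‖ * ‖x‖) :=
  calc ‖X‖ ^ 2 * (y * conj x).im - ‖x‖ ^ 2 * (Y * conj X).im
      = ((X * y - Y * x) * (conj X * conj x)).im := by
        rw [← normSq_eq_norm_sq, ← normSq_eq_norm_sq, normSq_apply, normSq_apply]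
        simp only [mul_im, sub_re, sub_im, mul_re, conj_re, conj_im]
        ring
    _ ≤ ‖X * y - Y * x‖ * (‖X‖ * ‖x‖) := by
        simpa only [norm_mul, RCLike.norm_conj] using
          im_le_norm ((X * y - Y * x) * (conj X * conj x))

theorem IsSolution.im_mul_tail_mul_norm_sq_le (h : IsSolution a z p q) (H : IsSolution a z P Q)
    {L : ℝ} (ha : ∀ n, |a n| ≤ L) (hp : Summable fun k => ‖p k‖ ^ 2) (hz : 0 ≤ z.im)
    (h₀ : (Q 0 * conj (P 0)).im ≤ 0) (n : ℕ) :
    z.im * ((∑' k, ‖p (k + n)‖ ^ 2) * ‖P n‖ ^ 2) ≤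
      ‖P 0 * q 0 - Q 0 * p 0‖ * (‖P n‖ * ‖p n‖) := by
  have hJ : (q n * conj (p n)).im = z.im * ∑' k, ‖p (k + n)‖ ^ 2 := by
    simpa using (h.shift n).current_eq_tsum (fun k => ha _) ((summable_nat_add_iff n).2 hp)
  have hK : (Q n * conj (P n)).im ≤ 0 := by
    have := mul_nonneg hz (Finset.sum_nonneg fun k (_ : k ∈ Finset.range n) => sq_nonneg ‖P k‖)
    linarith [H.current_eq_sum n]
  have hW := im_current_mul_norm_sq_sub_le (p n) (q n) (P n) (Q n)
  rw [h.wronskian_eq H, hJ] at hW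
  linarith [mul_nonpos_of_nonneg_of_nonpos (sq_nonneg ‖p n‖) hK]

theorem IsSolution.tail_mul_norm_sq_le (h : IsSolution a z p q) (H : IsSolution a z P Q)
    {L : ℝ} (ha : ∀ n, |a n| ≤ L) (hp : Summable fun k => ‖p k‖ ^ 2) (hz : 0 < z.im)
    (h₀ : (Q 0 * conj (P 0)).im ≤ 0) (n : ℕ) :
    (∑' k, ‖p (k + n)‖ ^ 2) * ‖P n‖ ^ 2 ≤ ‖P 0 * q 0 - Q 0 * p 0‖ ^ 2 / z.im ^ 2 := by
  have hbound := h.im_mul_tail_mul_norm_sq_le H ha hp hz.le h₀ n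
  have hpn : ‖p n‖ ^ 2 ≤ ∑' k, ‖p (k + n)‖ ^ 2 := by
    simpa using ((summable_nat_add_iff n).2 hp).le_tsum 0 fun k _ => sq_nonneg _
  set X := ∑' k, ‖p (k + n)‖ ^ 2
  set W := ‖P 0 * q 0 - Q 0 * p 0‖
  have hX : 0 ≤ X := (sq_nonneg _).trans hpn
  have hy : (√X * ‖P n‖) ^ 2 = X * ‖P n‖ ^ 2 := by rw [mul_pow, Real.sq_sqrt hX]
  rw [← hy] at hbound ⊢
  set y := √X * ‖P n‖
  have hlin : z.im * y ^ 2 ≤ W * y := hbound.trans <| by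
    rw [mul_comm ‖P n‖]
    exact mul_le_mul_of_nonneg_left (mul_le_mul_of_nonneg_right (Real.le_sqrt_of_sq_le hpn)
      (norm_nonneg _)) (norm_nonneg _)
  have hy₀ : 0 ≤ y := by positivity
  rw [← div_pow]
  refine pow_le_pow_left₀ hy₀ ((le_div_iff₀ hz).2 ?_) 2
  rcases hy₀.eq_or_lt with hy₀ | hy₀
  · simp only [← hy₀, zero_mul, W, norm_nonneg]
  · exact le_of_mul_le_mul_right (by linarith) hy₀

theorem IsSolution.tail_mul_norm_sq_add_le (h : IsSolution a z p q) (H : IsSolution a z P Q)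
    {L : ℝ} (ha : ∀ n, |a n| ≤ L) (hp : Summable fun k => ‖p k‖ ^ 2) (hz : 0 < z.im)
    (h₀ : (Q 0 * conj (P 0)).im ≤ 0) {n : ℕ} (hn : 1 ≤ n) :
    (∑' k, ‖p (k + n)‖ ^ 2) * (‖P n‖ ^ 2 + ‖Q n‖ ^ 2) ≤
      ‖P 0 * q 0 - Q 0 * p 0‖ ^ 2 / z.im ^ 2 * (1 + L ^ 2) := by
  obtain ⟨n, rfl⟩ := Nat.exists_eq_add_of_le' hn
  have hQ : ‖Q (n + 1)‖ ^ 2 ≤ L ^ 2 * ‖P n‖ ^ 2 := by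
    rw [(H n).1, norm_mul, mul_pow, norm_real, Real.norm_eq_abs]
    gcongr
    exact ha n
  have hX : ∑' k, ‖p (k + (n + 1))‖ ^ 2 ≤ ∑' k, ‖p (k + n)‖ ^ 2 := by
    have hsplit := ((summable_nat_add_iff n).2 hp).sum_add_tsum_nat_add 1
    simp only [Finset.sum_range_one, add_assoc, add_comm 1 n] at hsplit
    linarith [sq_nonneg ‖p (0 + n)‖]
  have hPn := h.tail_mul_norm_sq_le H ha hp hz h₀ n
  have hPn' := h.tail_mul_norm_sq_le H ha hp hz h₀ (n + 1)
  calc _ ≤ (∑' k, ‖p (k + (n + 1))‖ ^ 2) * ‖P (n + 1)‖ ^ 2 +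
        L ^ 2 * ((∑' k, ‖p (k + n)‖ ^ 2) * ‖P n‖ ^ 2) := by
        rw [mul_add, mul_left_comm (L ^ 2)]
        gcongr
    _ ≤ ‖P 0 * q 0 - Q 0 * p 0‖ ^ 2 / z.im ^ 2 +
        L ^ 2 * (‖P 0 * q 0 - Q 0 * p 0‖ ^ 2 / z.im ^ 2) := by gcongr
    _ = _ := by ring

end HalfLine

section Transfer

variable {a : ℤ → ℝ}

theorem norm_toEuclideanCLM_sq_le {n 𝕜 : Type*} [Fintype n] [DecidableEq n] [RCLike 𝕜]
    (M : Matrix n n 𝕜) :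
    ‖Matrix.toEuclideanCLM (n := n) (𝕜 := 𝕜) M‖ ^ 2 ≤ ∑ j, ∑ i, ‖M i j‖ ^ 2 := by
  rw [Finset.sum_comm, ← Real.le_sqrt (norm_nonneg _) (by positivity)]
  refine ContinuousLinearMap.opNorm_le_bound _ (Real.sqrt_nonneg _) fun x => ?_
  rw [← sq_le_sq₀ (norm_nonneg _) (by positivity), mul_pow, Real.sq_sqrt (by positivity),
    EuclideanSpace.norm_sq_eq, EuclideanSpace.norm_sq_eq, Finset.sum_mul]
  gcongr with i
  calc ‖∑ j, M i j * x j‖ ^ 2 ≤ (∑ j, ‖M i j‖ * ‖x j‖) ^ 2 := by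
        simp only [← norm_mul]
        gcongr
        exact norm_sum_le _ _
    _ ≤ (∑ j, ‖M i j‖ ^ 2) * ∑ j, ‖x j‖ ^ 2 := Finset.sum_mul_sq_le_sq_mul_sq _ _ _

theorem isSolution_transfer (ha : ∀ n, a n ≠ 0) (z : ℂ) (j : Fin 2) :
    IsSolution (fun n => a (n + 1)) z (fun n => transfer a n z 0 j)
      (fun n => transfer a n z 1 j) := fun n => by
  have ha' : (a (n + 1) : ℂ) ≠ 0 := ofReal_ne_zero.2 (ha _)
  simp only [transfer, stepMatrix, Matrix.mul_apply, Fin.sum_univ_two, Matrix.smul_apply,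
    Matrix.of_apply, Matrix.cons_val', Matrix.cons_val_zero, Matrix.cons_val_one, smul_eq_mul,
    Matrix.cons_val_fin_one]
  constructor <;> field_simp <;> ring

theorem IsSolution.tail_mul_transferNorm_le {z : ℂ} {p q : ℕ → ℂ}
    (h : IsSolution (fun n => a (n + 1)) z p q) (ha : ∀ n, a n ≠ 0) {L : ℝ}
    (hL : ∀ n, |a n| ≤ L) (hp : Summable fun k => ‖p k‖ ^ 2) (hz : 0 < z.im) {n : ℕ}
    (hn : 1 ≤ n) : (∑' k, ‖p (k + n)‖ ^ 2) * transferNorm a n z ^ 2 ≤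
      (‖p 0‖ ^ 2 + ‖q 0‖ ^ 2) / z.im ^ 2 * (1 + L ^ 2) := by
  have hcol₀ := h.tail_mul_norm_sq_add_le (isSolution_transfer ha z 0) (fun _ => hL _) hp hz
    (by simp [transfer]) hn
  have hcol₁ := h.tail_mul_norm_sq_add_le (isSolution_transfer ha z 1) (fun _ => hL _) hp hz
    (by simp [transfer]) hn
  simp only [transfer, Matrix.one_apply_eq, one_mul, ne_eq, zero_ne_one, one_ne_zero,
    not_false_eq_true, Matrix.one_apply_ne, zero_mul, sub_zero, zero_sub, norm_neg] at hcol₀ hcol₁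
  calc _ ≤ (∑' k, ‖p (k + n)‖ ^ 2) * ∑ j, ∑ i, ‖transfer a n z i j‖ ^ 2 := by
        gcongr
        exact norm_toEuclideanCLM_sq_le _
    _ ≤ ‖q 0‖ ^ 2 / z.im ^ 2 * (1 + L ^ 2) + ‖p 0‖ ^ 2 / z.im ^ 2 * (1 + L ^ 2) := by
        simp only [Fin.sum_univ_two, mul_add _ (_ + _) (_ + _)]
        exact add_le_add hcol₀ hcol₁
    _ = _ := by ring

theorem det_transfer (ha : ∀ n, a n ≠ 0) (n : ℕ) (z : ℂ) : (transfer a n z).det = 1 := by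
  induction n with
  | zero => simp [transfer]
  | succ n ih =>
    have ha' : (a (n + 1) : ℂ) ≠ 0 := ofReal_ne_zero.2 (ha _)
    rw [transfer, Matrix.det_mul, ih, mul_one, stepMatrix, Matrix.det_smul, Matrix.det_fin_two_of,
      Fintype.card_fin]
    field_simp
    ring

theorem transferNorm_pos (ha : ∀ n, a n ≠ 0) (n : ℕ) (z : ℂ) : 0 < transferNorm a n z := by
  refine norm_pos_iff.2 ((map_ne_zero_iff _ Matrix.toEuclideanCLM.injective).2 fun h => ?_)
  simpa [h] using det_transfer ha n z

theorem continuous_transfer (a : ℤ → ℝ) (n : ℕ) : Continuous (transfer a n) := by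
  induction n with
  | zero => exact continuous_const
  | succ n ih =>
    have hstep : Continuous (stepMatrix a (n + 1)) := by
      refine Continuous.const_smul (M := ℂ)
        (g := fun z : ℂ => !![z, -1; (a (n + 1) : ℂ) ^ 2, 0]) ?_ _
      refine continuous_matrix fun i j => ?_
      fin_cases i <;> fin_cases j
      exacts [continuous_id, continuous_const, continuous_const, continuous_const]
    exact hstep.matrix_mul ih

theorem continuous_transferNorm (a : ℤ → ℝ) (n : ℕ) : Continuous (transferNorm a n) :=
  ((LinearMap.continuous_of_finiteDimensional
    (Matrix.toEuclideanCLM (n := Fin 2) (𝕜 := ℂ)).toAlgEquiv.toLinearMap).comp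
      (continuous_transfer a n)).norm

theorem continuous_maxTransferSq (a : ℤ → ℝ) (N : ℕ) (hN : 1 ≤ N) :
    Continuous (maxTransferSq a N hN) :=
  Continuous.finset_sup'_apply _ fun n _ => (continuous_transferNorm a n).pow 2

theorem exists_maxTransferSq_eq (a : ℤ → ℝ) (N : ℕ) (hN : 1 ≤ N) (z : ℂ) :
    ∃ n, 1 ≤ n ∧ n ≤ N ∧ maxTransferSq a N hN z = transferNorm a n z ^ 2 := by
  obtain ⟨n, hn, h⟩ := Finset.exists_mem_eq_sup' (Finset.nonempty_Icc.2 hN)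
    fun n => transferNorm a n z ^ 2
  exact ⟨n, (Finset.mem_Icc.1 hn).1, (Finset.mem_Icc.1 hn).2, h⟩

theorem maxTransferSq_pos (ha : ∀ n, a n ≠ 0) (N : ℕ) (hN : 1 ≤ N) (z : ℂ) :
    0 < maxTransferSq a N hN z := by
  obtain ⟨n, -, -, h⟩ := exists_maxTransferSq_eq a N hN z
  exact h ▸ pow_pos (transferNorm_pos ha n z) 2

end Transfer

section TailMass

theorem tsum_subtype_lt_abs {G : Type*} [NormedAddCommGroup G] [CompleteSpace G] {g : ℤ → G}
    (hg : Summable g) (N : ℕ) : ∑' n : {n : ℤ // (N : ℤ) < |n|}, g n =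
      ∑' k : ℕ, g ((k + N : ℕ) + 1) + ∑' k : ℕ, g (-((k + N : ℕ) + 1)) := by
  set s : Set ℤ := {n | (N : ℤ) < |n|}
  have hs : Summable (s.indicator g) := hg.indicator s
  have hpos : Summable fun k : ℕ => s.indicator g (k + 1) :=
    hs.comp_injective (i := fun k : ℕ => (k : ℤ) + 1) fun i j h => by simpa using h
  have hneg : Summable fun k : ℕ => s.indicator g (-(k + 1)) :=
    hs.comp_injective (i := fun k : ℕ => -((k : ℤ) + 1)) fun i j h => by simpa using h
  have hzero : ∀ n : ℤ, |n| ≤ N → s.indicator g n = 0 := fun n hn =>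
    Set.indicator_of_notMem (s := s) (not_lt.2 hn) g
  have hmem : ∀ n : ℤ, N < |n| → s.indicator g n = g n := fun n hn =>
    Set.indicator_of_mem (s := s) hn g
  rw [show ∑' n : {n : ℤ // (N : ℤ) < |n|}, g n = ∑' n, s.indicator g n from tsum_subtype s g,
    tsum_of_add_one_of_neg_add_one hpos hneg, hzero 0 (by simp), add_zero,
    ← hpos.sum_add_tsum_nat_add N, ← hneg.sum_add_tsum_nat_add N,
    Finset.sum_eq_zero fun k hk => hzero _ ?_, Finset.sum_eq_zero fun k hk => hzero _ ?_,
    zero_add, zero_add]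
  · exact congrArg₂ _ (tsum_congr fun k => hmem _ (by grind))
      (tsum_congr fun k => hmem _ (by grind))
  all_goals grind

/-- The mass `∑_{|n| > N} |f(n)|²` that a sequence carries outside `[-N, N]`. -/
noncomputable def tailMass (N : ℕ) (f : ℤ → ℂ) : ℝ :=
  ∑' n : {n : ℤ // (N : ℤ) < |n|}, ‖f n‖ ^ 2

theorem summable_norm_sq (u : ell2Z) : Summable fun n => ‖u n‖ ^ 2 :=
  (memℓp_two_iff _).1 (lp.memℓp u)

theorem tailMass_nonneg (N : ℕ) (f : ℤ → ℂ) : 0 ≤ tailMass N f := tsum_nonneg fun _ => sq_nonneg _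

theorem tailMass_congr {N : ℕ} {f g : ℤ → ℂ} (h : ∀ n : ℤ, N < |n| → f n = g n) :
    tailMass N f = tailMass N g :=
  tsum_congr fun n => by rw [h n n.2]

theorem tailMass_const_mul (N : ℕ) (c : ℂ) (f : ℤ → ℂ) :
    tailMass N (fun n => c * f n) = ‖c‖ ^ 2 * tailMass N f := by
  simp only [tailMass, norm_mul, mul_pow, tsum_mul_left]

theorem tailMass_le_norm_sq (N : ℕ) (u : ell2Z) : tailMass N u ≤ ‖u‖ ^ 2 := by
  have h := lp.norm_rpow_eq_tsum (by norm_num : 0 < (2 : ENNReal).toReal) u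
  simp only [ENNReal.toReal_ofNat, Real.rpow_ofNat] at h
  exact h ▸ (summable_norm_sq u).tsum_subtype_le _ _ fun _ => sq_nonneg _

theorem tailMass_anti {m N : ℕ} (hmN : m ≤ N) (u : ell2Z) : tailMass N u ≤ tailMass m u :=
  calc tailMass N u = ∑' n, {n : ℤ | (N : ℤ) < |n|}.indicator (fun n => ‖u n‖ ^ 2) n :=
        tsum_subtype {n : ℤ | (N : ℤ) < |n|} fun n => ‖u n‖ ^ 2
    _ ≤ ∑' n, {n : ℤ | (m : ℤ) < |n|}.indicator (fun n => ‖u n‖ ^ 2) n :=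
        ((summable_norm_sq u).indicator _).tsum_le_tsum
          (Set.indicator_le_indicator_of_subset (fun _ => (Int.ofNat_le.2 hmN).trans_lt)
            fun _ => sq_nonneg _) ((summable_norm_sq u).indicator _)
    _ = tailMass m u := (tsum_subtype {n : ℤ | (m : ℤ) < |n|} fun n => ‖u n‖ ^ 2).symm

theorem tailMass_eq_add (N : ℕ) (u : ell2Z) : tailMass N u =
    ∑' k : ℕ, ‖u ((k + N : ℕ) + 1)‖ ^ 2 + ∑' k : ℕ, ‖u (-((k + N : ℕ) + 1))‖ ^ 2 :=
  tsum_subtype_lt_abs (summable_norm_sq u) N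

end TailMass

section Parseval

variable {H : ell2Z →L[ℂ] ell2Z} {T : ℝ}

theorem ofReal_add_I_div (E T : ℝ) : (E : ℂ) + I / T = E + (T⁻¹ : ℝ) * I := by
  rw [ofReal_inv, div_eq_inv_mul]

theorem integrable_norm_resolvent_delta_sq (hH : IsSelfAdjoint H) (hT : 0 < T) (k n : ℤ) :
    Integrable fun E : ℝ => ‖resolvent H (E + I / T) (delta k) n‖ ^ 2 := by
  simp only [ofReal_add_I_div]
  exact integrable_norm_apply_resolvent_sq (lp.evalCLM ℂ (fun _ : ℤ => ℂ) 2 n) hH (delta k)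
    (inv_pos.2 hT)

theorem avgSiteProb_eq_integral_resolvent (hH : IsSelfAdjoint H) (hT : 0 < T) (n : ℤ) :
    avgSiteProb H n T =
      (Real.pi * T)⁻¹ * ∫ E : ℝ, ‖resolvent H (E + I / T) (delta 1) n‖ ^ 2 := by
  have h := integral_norm_apply_propagator_sq (lp.evalCLM ℂ (fun _ : ℤ => ℂ) 2 n) hH (delta 1)
    (inv_pos.2 hT)
  have hprob : ∀ t, Real.exp (-2 * t / T) * siteProb H n t = Real.exp (-2 * T⁻¹ * t) *
      ‖lp.evalCLM ℂ (fun _ : ℤ => ℂ) 2 n (propagator H t (delta 1))‖ ^ 2 := fun t => by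
    rw [siteProb_eq, div_eq_mul_inv, mul_right_comm]
    rfl
  simp only [avgSiteProb, hprob, h, ofReal_add_I_div]
  rw [← mul_assoc]
  congr 1
  field_simp

theorem avgOutsideProb_eq_integral_tailMass (hH : IsSelfAdjoint H) (hT : 0 < T) (N : ℕ) :
    avgOutsideProb H N T =
      (Real.pi * T)⁻¹ * ∫ E : ℝ, tailMass N (resolvent H (E + I / T) (delta 1)) := by
  have hsum := (avgSiteProb_summable hH hT).subtype {n : ℤ | (N : ℤ) < |n|}
  have hπT : (Real.pi * T)⁻¹ ≠ 0 := by positivity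
  simp only [avgSiteProb_eq_integral_resolvent hH hT, Function.comp_def,
    summable_mul_left_iff hπT] at hsum
  simp only [avgOutsideProb, avgSiteProb_eq_integral_resolvent hH hT, tsum_mul_left]
  congr 1
  refine integral_tsum_of_summable_integral_norm
    (F := fun (n : {n : ℤ // (N : ℤ) < |n|}) (E : ℝ) =>
      ‖resolvent H (E + I / T) (delta 1) n‖ ^ 2)
    (fun n => integrable_norm_resolvent_delta_sq hH hT 1 n) ?_
  simp only [norm_pow, norm_norm]
  exact hsum

end Parseval

section Locality

variable {a b : ℤ → ℝ} (ha : ∃ C, ∀ n, |a n| ≤ C) (hb : ∃ C, ∀ n, |b n| ≤ C)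

theorem delta_apply (k n : ℤ) : delta k n = if n = k then 1 else 0 := by
  simp [delta, lp.single_apply, Pi.single_apply]

theorem norm_delta (k : ℤ) : ‖delta k‖ = 1 := by
  simp [delta, lp.norm_single]

theorem jacobi_pow_delta_apply_of_lt (m : ℕ) {k n : ℤ} (h : m < |n - k|) :
    ((jacobi a b ha hb) ^ m) (delta k) n = 0 := by
  induction m generalizing n with
  | zero => simp_all [delta_apply, sub_eq_zero]
  | succ m ih =>
    rw [pow_succ', mul_apply_eq_comp, jacobi_apply, ih, ih, ih]
    · simp
    all_goals grind

theorem jacobi_pow_resolvent_delta_apply {z : ℂ} (hz : z.im ≠ 0) (m : ℕ) {k n : ℤ}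
    (h : m ≤ |n - k|) :
    ((jacobi a b ha hb) ^ m) (resolvent (jacobi a b ha hb) z (delta k)) n =
      z ^ m * resolvent (jacobi a b ha hb) z (delta k) n := by
  induction m with
  | zero => simp
  | succ m ih =>
    have hres := smul_resolvent_sub_apply_resolvent (jacobi_isSelfAdjoint a b ha hb) hz (delta k)
    have hH : jacobi a b ha hb (resolvent (jacobi a b ha hb) z (delta k)) =
        z • resolvent (jacobi a b ha hb) z (delta k) - delta k :=
      eq_sub_of_add_eq (sub_eq_iff_eq_add'.1 hres).symm
    rw [pow_succ, mul_apply_eq_comp, hH, map_sub, map_smul, lp.coeFn_sub, lp.coeFn_smul,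
      Pi.sub_apply, Pi.smul_apply, ih (by grind), jacobi_pow_delta_apply_of_lt ha hb m (by grind),
      sub_zero, smul_eq_mul, pow_succ', mul_assoc]

theorem norm_pow_mul_tailMass_resolvent_le {z : ℂ} (hz : z.im ≠ 0) (N : ℕ) :
    ‖z‖ ^ (2 * N) * tailMass N (resolvent (jacobi a b ha hb) z (delta 1)) ≤
      (‖jacobi a b ha hb‖ ^ N * ‖resolvent (jacobi a b ha hb) z (delta 1)‖) ^ 2 := by
  set H := jacobi a b ha hb
  set u := resolvent H z (delta 1)
  have hpow : tailMass N ((H ^ N) u) = ‖z‖ ^ (2 * N) * tailMass N u := by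
    rw [pow_mul', ← norm_pow, ← tailMass_const_mul]
    exact tailMass_congr fun n hn => jacobi_pow_resolvent_delta_apply ha hb hz N (by grind)
  have : Nontrivial ell2Z := ⟨delta 0, 0, norm_ne_zero_iff.1 (by simp [norm_delta])⟩
  rw [← hpow]
  refine (tailMass_le_norm_sq N _).trans ?_
  gcongr
  exact (H ^ N).le_of_opNorm_le (norm_pow_le H N) u

theorem tailMass_resolvent_le_of_le_norm {K : ℝ} (hK : 1 < K) (hnorm : ‖jacobi a b ha hb‖ ≤ K - 1)
    {z : ℂ} (hz : z.im ≠ 0) (hzK : K ≤ ‖z‖) (N : ℕ) :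
    tailMass N (resolvent (jacobi a b ha hb) z (delta 1)) ≤
      K ^ 2 * ((K - 1) / K) ^ (2 * N) / ‖z‖ ^ 2 := by
  have htail := norm_pow_mul_tailMass_resolvent_le ha hb hz N
  have hres := norm_resolvent_apply_le_of_norm_lt (jacobi_isSelfAdjoint a b ha hb) hz
    (by linarith) (delta 1)
  have hK₁ : 0 ≤ K - 1 := by linarith
  have hz₀ : 0 < ‖z‖ := by linarith
  rw [norm_delta] at hres
  set H := jacobi a b ha hb
  set u := resolvent H z (delta 1)
  have hu : ‖u‖ ≤ K / ‖z‖ := hres.trans <| by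
    rw [div_le_div_iff₀ (by linarith) hz₀]
    nlinarith
  calc tailMass N u ≤ (‖H‖ ^ N * ‖u‖) ^ 2 / ‖z‖ ^ (2 * N) :=
        (le_div_iff₀' (by positivity)).2 htail
    _ ≤ ((K - 1) ^ N * (K / ‖z‖)) ^ 2 / K ^ (2 * N) := by gcongr
    _ = K ^ 2 * ((K - 1) / K) ^ (2 * N) / ‖z‖ ^ 2 := by
        rw [div_pow, mul_pow, ← pow_mul', div_pow]
        ring

end Locality

section OffDiag

variable {a : ℤ → ℝ} {L : ℝ} {z : ℂ}

theorem isSolution_of_recurrence {b : ℕ → ℝ} {w : ℕ → ℂ}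
    (h : ∀ n, z * w (n + 1) = b (n + 1) * w (n + 2) + b n * w n) :
    IsSolution b z w fun n => z * w n - b n * w (n + 1) := fun n =>
  ⟨by linear_combination h n, by ring⟩

theorem tail_mul_transferNorm_le_of_recurrence (ha : ∀ n, a n ≠ 0) (hL : ∀ n, |a n| ≤ L)
    {w : ℕ → ℂ} (h : ∀ n : ℕ, z * w (n + 1) = a (n + 2) * w (n + 2) + a (n + 1) * w n)
    (hw : Summable fun k => ‖w k‖ ^ 2) {B : ℝ} (hB : ∀ k, ‖w k‖ ≤ B) (hz : 0 < z.im) {m : ℕ}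
    (hm : 1 ≤ m) : (∑' k, ‖w (k + m)‖ ^ 2) * transferNorm a m z ^ 2 ≤
      (1 + (‖z‖ + L) ^ 2) * (1 + L ^ 2) * B ^ 2 / z.im ^ 2 := by
  have hsol : IsSolution (fun n => a (n + 1)) z w fun n => z * w n - a (n + 1) * w (n + 1) :=
    isSolution_of_recurrence fun n => by simpa [add_assoc, one_add_one_eq_two] using h n
  have hL₀ : 0 ≤ L := (abs_nonneg _).trans (hL 0)
  have hq : ‖z * w 0 - a 1 * w 1‖ ≤ (‖z‖ + L) * B := by
    refine (norm_sub_le _ _).trans ?_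
    rw [norm_mul, norm_mul, norm_real, Real.norm_eq_abs, add_mul]
    gcongr
    exacts [hB 0, hL 1, hB 1]
  refine (hsol.tail_mul_transferNorm_le ha hL hw hz hm).trans ?_
  calc (‖w 0‖ ^ 2 + ‖z * w 0 - a ((0 : ℕ) + 1) * w (0 + 1)‖ ^ 2) / z.im ^ 2 * (1 + L ^ 2)
      ≤ (B ^ 2 + ((‖z‖ + L) * B) ^ 2) / z.im ^ 2 * (1 + L ^ 2) := by
        simp only [Nat.cast_zero, zero_add]
        gcongr
        exact hB 0
    _ = (1 + (‖z‖ + L) ^ 2) * (1 + L ^ 2) * B ^ 2 / z.im ^ 2 := by ring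

/-- The off-diagonal Jacobi operator `(Hψ)(n) = a(n) ψ(n+1) + a(n-1) ψ(n-1)`;
`sturmH` is the case of Sturmian hopping coefficients. -/
noncomputable def offDiag (a : ℤ → ℝ) (hL : ∀ n, |a n| ≤ L) : ell2Z →L[ℂ] ell2Z :=
  jacobi a (fun _ => 0) ⟨L, hL⟩ ⟨0, fun _ => abs_zero.le⟩

variable (hL : ∀ n, |a n| ≤ L)

theorem isSelfAdjoint_offDiag : IsSelfAdjoint (offDiag a hL) := jacobi_isSelfAdjoint _ _ _ _

theorem mul_resolvent_offDiag_apply (hz : z.im ≠ 0) {n : ℤ} (hn : n ≠ 1) :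
    z * resolvent (offDiag a hL) z (delta 1) n =
      a n * resolvent (offDiag a hL) z (delta 1) (n + 1) +
        a (n - 1) * resolvent (offDiag a hL) z (delta 1) (n - 1) := by
  have h := congrArg (fun u : ell2Z => u n)
    (smul_resolvent_sub_apply_resolvent (isSelfAdjoint_offDiag hL) hz (delta 1))
  simp only [lp.coeFn_sub, lp.coeFn_smul, Pi.sub_apply, Pi.smul_apply, smul_eq_mul, delta_apply,
    if_neg hn, sub_eq_zero] at h
  rw [h, offDiag, jacobi_apply, ofReal_zero, zero_mul, add_zero]

theorem mul_resolvent_offDiag_apply_right (hz : z.im ≠ 0) (n : ℕ) :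
    z * resolvent (offDiag a hL) z (delta 1) ((n + 1 : ℕ) + 1) =
      a (n + 2) * resolvent (offDiag a hL) z (delta 1) ((n + 2 : ℕ) + 1) +
        a (n + 1) * resolvent (offDiag a hL) z (delta 1) (n + 1) := by
  convert mul_resolvent_offDiag_apply hL hz (n := n + 2) (by omega) using 3 <;>
    push_cast <;> ring_nf

theorem mul_resolvent_offDiag_apply_left (hrefl : ∀ n, 1 ≤ n → a (-n - 1) = a n) (hz : z.im ≠ 0)
    (n : ℕ) : z * resolvent (offDiag a hL) z (delta 1) (-((n + 1 : ℕ) + 1)) =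
      a (n + 2) * resolvent (offDiag a hL) z (delta 1) (-((n + 2 : ℕ) + 1)) +
        a (n + 1) * resolvent (offDiag a hL) z (delta 1) (-(n + 1)) := by
  have h := mul_resolvent_offDiag_apply hL hz (n := -(n + 1) - 1) (by omega)
  rw [hrefl (n + 1) (by omega), show -(n + 1 : ℤ) - 1 - 1 = -(n + 2) - 1 by ring,
    hrefl (n + 2) (by omega), sub_add_cancel] at h
  convert h.trans (add_comm _ _) using 3 <;> push_cast <;> ring_nf

theorem norm_resolvent_offDiag_apply_le (hz : 0 < z.im) (n : ℤ) :
    ‖resolvent (offDiag a hL) z (delta 1) n‖ ≤ z.im⁻¹ := by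
  refine (lp.norm_apply_le_norm two_ne_zero _ n).trans ?_
  simpa [norm_delta] using norm_resolvent_apply_le (isSelfAdjoint_offDiag hL) hz (delta 1)

theorem tailMass_resolvent_mul_transferNorm_le (ha : ∀ n, a n ≠ 0)
    (hrefl : ∀ n, 1 ≤ n → a (-n - 1) = a n) (hz : 0 < z.im) {m : ℕ} (hm : 1 ≤ m) :
    tailMass m (resolvent (offDiag a hL) z (delta 1)) * transferNorm a m z ^ 2 ≤
      2 * (1 + (‖z‖ + L) ^ 2) * (1 + L ^ 2) / z.im ^ 4 := by
  have hbound := norm_resolvent_offDiag_apply_le hL hz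
  set u := resolvent (offDiag a hL) z (delta 1)
  have hright := tail_mul_transferNorm_le_of_recurrence (w := fun k => u (k + 1)) ha hL
    (mul_resolvent_offDiag_apply_right hL hz.ne')
    ((summable_norm_sq u).comp_injective (i := fun k : ℕ => (k : ℤ) + 1)
      fun i j h => by simpa using h) (fun k => hbound _) hz hm
  have hleft := tail_mul_transferNorm_le_of_recurrence (w := fun k => u (-(k + 1))) ha hL
    (mul_resolvent_offDiag_apply_left hL hrefl hz.ne')
    ((summable_norm_sq u).comp_injective (i := fun k : ℕ => -((k : ℤ) + 1))
      fun i j h => by simpa using h) (fun k => hbound _) hz hm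
  rw [tailMass_eq_add, add_mul]
  refine (add_le_add hright hleft).trans_eq ?_
  field_simp
  ring

theorem tailMass_resolvent_le_inv_maxTransferSq (ha : ∀ n, a n ≠ 0)
    (hrefl : ∀ n, 1 ≤ n → a (-n - 1) = a n) (hz : 0 < z.im) (N : ℕ) (hN : 1 ≤ N) :
    tailMass N (resolvent (offDiag a hL) z (delta 1)) ≤
      2 * (1 + (‖z‖ + L) ^ 2) * (1 + L ^ 2) / z.im ^ 4 * (maxTransferSq a N hN z)⁻¹ := by
  obtain ⟨m, hm, hmN, hmax⟩ := exists_maxTransferSq_eq a N hN z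
  rw [← div_eq_mul_inv, le_div_iff₀ (maxTransferSq_pos ha N hN z), hmax]
  refine le_trans ?_ (tailMass_resolvent_mul_transferNorm_le hL ha hrefl hz hm)
  gcongr
  exact tailMass_anti hmN _

end OffDiag

section Energy

theorem integrable_inv_one_add_mul_sq {T : ℝ} (hT : T ≠ 0) :
    Integrable fun E : ℝ => (1 + (T * E) ^ 2)⁻¹ :=
  (integrable_comp_mul_left_iff (fun x : ℝ => (1 + x ^ 2)⁻¹) hT).2 integrable_inv_one_add_sq

theorem integral_inv_one_add_mul_sq {T : ℝ} (hT : 0 < T) :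
    ∫ E : ℝ, (1 + (T * E) ^ 2)⁻¹ = Real.pi / T := by
  rw [Measure.integral_comp_mul_left (fun x : ℝ => (1 + x ^ 2)⁻¹), integral_univ_inv_one_add_sq,
    abs_of_pos (by positivity), smul_eq_mul, inv_mul_eq_div]

theorem norm_ofReal_add_I_div_sq (E T : ℝ) : ‖(E : ℂ) + I / T‖ ^ 2 = E ^ 2 + (1 / T) ^ 2 := by
  rw [← normSq_eq_norm_sq, normSq_apply]
  simp [div_ofReal_im, div_ofReal_re]
  ring

end Energy

section EnergyIntegral

variable {a : ℤ → ℝ} {K L : ℝ} (hL : ∀ n, |a n| ≤ L)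

theorem tailMass_resolvent_offDiag_le_of_le (ha : ∀ n, a n ≠ 0)
    (hrefl : ∀ n, 1 ≤ n → a (-n - 1) = a n) (N : ℕ) (hN : 1 ≤ N) {T : ℝ} (hT : 0 < T)
    (hTK : 1 / T ≤ K) {E : ℝ} (hE : |E| ≤ K) :
    tailMass N (resolvent (offDiag a hL) (E + I / T) (delta 1)) ≤
      2 * (1 + (2 * K + L) ^ 2) * (1 + L ^ 2) * T ^ 4 * (maxTransferSq a N hN (E + I / T))⁻¹ := by
  have him : ((E : ℂ) + I / T).im = 1 / T := by simp [div_ofReal_im]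
  have hnorm : ‖(E : ℂ) + I / T‖ ≤ 2 * K := by
    refine (norm_add_le _ _).trans ?_
    rw [norm_div, norm_I, norm_real, norm_real, Real.norm_eq_abs, Real.norm_of_nonneg hT.le]
    linarith
  have hL₀ : 0 ≤ L := (abs_nonneg _).trans (hL 0)
  have hpos := maxTransferSq_pos ha N hN (E + I / T)
  refine (tailMass_resolvent_le_inv_maxTransferSq hL ha hrefl (by rw [him]; positivity) N
    hN).trans ?_
  rw [him, one_div_pow, div_div_eq_mul_div, div_one]
  gcongr

theorem tailMass_resolvent_offDiag_le_of_lt (hK : 1 < K) (hnorm : ‖offDiag a hL‖ ≤ K - 1) (N : ℕ)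
    {T : ℝ} (hT : 0 < T) {E : ℝ} (hKE : K ^ 2 ≤ E ^ 2 + (1 / T) ^ 2) :
    tailMass N (resolvent (offDiag a hL) (E + I / T) (delta 1)) ≤
      K ^ 2 * ((K - 1) / K) ^ (2 * N) * T ^ 2 * (1 + (T * E) ^ 2)⁻¹ := by
  have hz : ((E : ℂ) + I / T).im ≠ 0 := by simp [div_ofReal_im, hT.ne']
  have hzK : K ≤ ‖(E : ℂ) + I / T‖ :=
    le_of_sq_le_sq (by rwa [norm_ofReal_add_I_div_sq]) (norm_nonneg _)
  refine (tailMass_resolvent_le_of_le_norm ⟨L, hL⟩ ⟨0, fun _ => abs_zero.le⟩ hK hnorm hz hzK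
    N).trans_eq ?_
  rw [norm_ofReal_add_I_div_sq]
  field_simp
  ring

theorem tailMass_resolvent_offDiag_le (hK : 1 < K) (hnorm : ‖offDiag a hL‖ ≤ K - 1)
    (ha : ∀ n, a n ≠ 0) (hrefl : ∀ n, 1 ≤ n → a (-n - 1) = a n) (N : ℕ) (hN : 1 ≤ N) {T : ℝ}
    (hT : 0 < T) (E : ℝ) :
    tailMass N (resolvent (offDiag a hL) (E + I / T) (delta 1)) ≤
      K ^ 2 * ((K - 1) / K) ^ (2 * N) * T ^ 2 * (1 + (T * E) ^ 2)⁻¹ +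
        (Set.Ioc (-K) K).indicator (fun E : ℝ =>
          2 * (1 + (2 * K + L) ^ 2) * (1 + L ^ 2) * T ^ 4 *
            (maxTransferSq a N hN (E + I / T))⁻¹) E := by
  by_cases hE : E ∈ Set.Ioc (-K) K ∧ 1 / T ≤ K
  · rw [Set.indicator_of_mem hE.1]
    refine le_add_of_nonneg_of_le ?_ (tailMass_resolvent_offDiag_le_of_le hL ha hrefl N hN hT hE.2
      (abs_le.2 ⟨hE.1.1.le, hE.1.2⟩))
    have := (even_two_mul N).pow_nonneg ((K - 1) / K)
    positivity
  · refine le_add_of_le_of_nonneg (tailMass_resolvent_offDiag_le_of_lt hL hK hnorm N hT ?_)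
      (Set.indicator_nonneg (fun E _ => ?_) E)
    · rw [not_and_or, Set.mem_Ioc, not_and_or] at hE
      have : 0 < 1 / T := by positivity
      rcases hE with (h | h) | h <;> nlinarith
    · have := maxTransferSq_pos ha N hN (E + I / T)
      positivity

theorem integral_tailMass_resolvent_offDiag_le (hK : 1 < K) (hnorm : ‖offDiag a hL‖ ≤ K - 1)
    (ha : ∀ n, a n ≠ 0) (hrefl : ∀ n, 1 ≤ n → a (-n - 1) = a n) (N : ℕ) (hN : 1 ≤ N) {T : ℝ}
    (hT : 0 < T) :
    ∫ E : ℝ, tailMass N (resolvent (offDiag a hL) (E + I / T) (delta 1)) ≤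
      K ^ 2 * ((K - 1) / K) ^ (2 * N) * T ^ 2 * (Real.pi / T) +
        2 * (1 + (2 * K + L) ^ 2) * (1 + L ^ 2) * T ^ 4 *
          ∫ E in (-K)..K, (maxTransferSq a N hN (E + I / T))⁻¹ := by
  have hcont : Continuous fun E : ℝ => (maxTransferSq a N hN (E + I / T))⁻¹ :=
    ((continuous_maxTransferSq a N hN).comp (by fun_prop)).inv₀
      fun E => (maxTransferSq_pos ha N hN _).ne'
  have houter := (integrable_inv_one_add_mul_sq hT.ne').const_mul
    (K ^ 2 * ((K - 1) / K) ^ (2 * N) * T ^ 2)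
  have hinner := (integrable_indicator_iff measurableSet_Ioc).2
    ((hcont.integrableOn_Ioc (a := -K) (b := K) (μ := volume)).const_mul
      (2 * (1 + (2 * K + L) ^ 2) * (1 + L ^ 2) * T ^ 4))
  refine (integral_mono_of_nonneg (Eventually.of_forall fun E => tailMass_nonneg N _)
    (houter.add hinner) (Eventually.of_forall
      (tailMass_resolvent_offDiag_le hL hK hnorm ha hrefl N hN hT))).trans_eq ?_
  rw [integral_add' houter hinner, integral_const_mul, integral_inv_one_add_mul_sq hT,
    integral_indicator measurableSet_Ioc, integral_const_mul,
    intervalIntegral.integral_of_le (by linarith)]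

theorem avgOutsideProb_offDiag_le (hK : 1 < K) (hnorm : ‖offDiag a hL‖ ≤ K - 1)
    (ha : ∀ n, a n ≠ 0) (hrefl : ∀ n, 1 ≤ n → a (-n - 1) = a n) (N : ℕ) (hN : 1 ≤ N) {T : ℝ}
    (hT : 0 < T) :
    avgOutsideProb (offDiag a hL) N T ≤ K ^ 2 * ((K - 1) / K) ^ (2 * N) +
      2 * (1 + (2 * K + L) ^ 2) * (1 + L ^ 2) / Real.pi *
        (T ^ 3 * ∫ E in (-K)..K, (maxTransferSq a N hN (E + I / T))⁻¹) := by
  rw [avgOutsideProb_eq_integral_tailMass (isSelfAdjoint_offDiag hL) hT]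
  refine (mul_le_mul_of_nonneg_left (integral_tailMass_resolvent_offDiag_le hL hK hnorm ha hrefl N
    hN hT) (by positivity)).trans_eq ?_
  field_simp

end EnergyIntegral

theorem exp_neg_two_mul_log_mul {x : ℝ} (hx : 0 < x) (n : ℕ) :
    Real.exp (-(2 * Real.log x) * n) = x⁻¹ ^ (2 * n) := by
  rw [show -(2 * Real.log x) * n = ((2 * n : ℕ) : ℝ) * -Real.log x by push_cast; ring,
    Real.exp_nat_mul, Real.exp_neg, Real.exp_log hx]

section Hop

variable {l₁ l₂ β : ℝ}

theorem hop_eq_or (l₁ l₂ : ℝ) (hβ : β ∈ Set.Icc (0 : ℝ) 1) (n : ℤ) :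
    hop l₁ l₂ β n = l₁ ∨ hop l₁ l₂ β n = l₂ := by
  have hmono : ⌊(n : ℝ) * β⌋ ≤ ⌊((n : ℝ) + 1) * β⌋ := Int.floor_mono (by nlinarith [hβ.1])
  have hstep : ⌊((n : ℝ) + 1) * β⌋ ≤ ⌊(n : ℝ) * β⌋ + 1 := by
    rw [← Int.floor_add_one]
    exact Int.floor_mono (by nlinarith [hβ.2])
  rcases (by omega : ⌊((n : ℝ) + 1) * β⌋ - ⌊(n : ℝ) * β⌋ = 1 ∨
    ⌊((n : ℝ) + 1) * β⌋ - ⌊(n : ℝ) * β⌋ = 0) with h | h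
  · left
    rw [hop, h]
    simp
  · right
    rw [hop, h]
    simp

theorem hop_pos (hl₁ : 0 < l₁) (hl₂ : 0 < l₂) (hβ : β ∈ Set.Icc (0 : ℝ) 1) (n : ℤ) :
    0 < hop l₁ l₂ β n := by
  rcases hop_eq_or l₁ l₂ hβ n with h | h <;> rw [h] <;> assumption

theorem abs_hop_le (hl₁ : 0 < l₁) (hl₂ : 0 < l₂) (hβ : β ∈ Set.Icc (0 : ℝ) 1) (n : ℤ) :
    |hop l₁ l₂ β n| ≤ l₁ + l₂ := by
  rw [abs_of_pos (hop_pos hl₁ hl₂ hβ n)]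
  rcases hop_eq_or l₁ l₂ hβ n with h | h <;> rw [h] <;> linarith

theorem floor_neg_of_irrational {x : ℝ} (hx : Irrational x) : ⌊-x⌋ = -⌊x⌋ - 1 := by
  rw [Int.floor_eq_iff]
  have hlt := (Int.floor_le x).lt_of_ne (hx.ne_int _).symm
  have := Int.lt_floor_add_one x
  push_cast
  constructor <;> linarith

theorem hop_neg_sub_one (l₁ l₂ : ℝ) (hβ : Irrational β) {n : ℤ} (h₀ : n ≠ 0) (h₁ : n + 1 ≠ 0) :
    hop l₁ l₂ β (-n - 1) = hop l₁ l₂ β n := by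
  have hn : Irrational ((n : ℝ) * β) := hβ.intCast_mul h₀
  have hn' : Irrational (((n : ℝ) + 1) * β) := by exact_mod_cast hβ.intCast_mul h₁
  have hleft : ((-n - 1 : ℤ) : ℝ) * β = -(((n : ℝ) + 1) * β) := by push_cast; ring
  have hright : (((-n - 1 : ℤ) : ℝ) + 1) * β = -((n : ℝ) * β) := by push_cast; ring
  rw [hop, hop, hleft, hright, floor_neg_of_irrational hn, floor_neg_of_irrational hn']
  congr 3
  omega

end Hop

end OffDiagSturm

open Complex OffDiagSturm in
theorem theorem2_general (K L : ℝ) (hK : 1 < K) :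
    ∃ c : ℝ, 0 < c ∧ ∃ C : ℝ, 0 < C ∧
      ∀ (a : ℤ → ℝ) (hL : ∀ n, |a n| ≤ L), (∀ n, a n ≠ 0) →
        (∀ n, 1 ≤ n → a (-n - 1) = a n) →
        spectrum ℂ (offDiag a hL) ⊆ ofReal '' Set.Icc (-K + 1) (K - 1) →
        ∀ (N : ℕ) (hN : 1 ≤ N) (T : ℝ), 0 < T →
          avgOutsideProb (offDiag a hL) N T ≤
            C * (Real.exp (-c * N) +
              T ^ 3 * ∫ E in (-K)..K, (maxTransferSq a N hN ((E : ℂ) + I / (T : ℂ)))⁻¹) := by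
  have hK₁ : 0 < K - 1 := sub_pos.2 hK
  have hlog : 0 < Real.log (K / (K - 1)) := Real.log_pos ((one_lt_div hK₁).2 (by linarith))
  set D := 2 * (1 + (2 * K + L) ^ 2) * (1 + L ^ 2)
  refine ⟨2 * Real.log (K / (K - 1)), by positivity, K ^ 2 + D, by positivity, ?_⟩
  intro a hL ha hrefl hspec N hN T hT
  have hnorm : ‖offDiag a hL‖ ≤ K - 1 := by
    refine norm_le_of_spectrum_subset_Icc (isSelfAdjoint_offDiag hL) hK₁.le ?_
    rwa [neg_sub, ← neg_add_eq_sub]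
  have hJ : 0 ≤ T ^ 3 * ∫ E in (-K)..K, (maxTransferSq a N hN (E + I / T))⁻¹ :=
    mul_nonneg (by positivity) (intervalIntegral.integral_nonneg (by linarith)
      fun E _ => inv_nonneg.2 (maxTransferSq_pos ha N hN _).le)
  rw [exp_neg_two_mul_log_mul (by positivity), inv_div, add_mul, mul_add, mul_add]
  have hDpi : D / Real.pi ≤ D := div_le_self (by positivity) (by linarith [Real.pi_gt_three])
  have hρ : 0 ≤ D * ((K - 1) / K) ^ (2 * N) := by positivity
  have hbound := avgOutsideProb_offDiag_le hL hK hnorm ha hrefl N hN hT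
  have := mul_le_mul_of_nonneg_right hDpi hJ
  have := mul_nonneg (sq_nonneg K) hJ
  linarith

theorem theorem2 (l₁ l₂ K : ℝ) (hl₁ : 0 < l₁) (hl₂ : 0 < l₂) (hK : 4 ≤ K) :
    ∃ c : ℝ, 0 < c ∧ ∃ C : ℝ, 0 < C ∧
      ∀ β ∈ Set.Icc (0 : ℝ) 1, Irrational β →
        spectrum ℂ (OffDiagSturm.sturmH l₁ l₂ β) ⊆
          Complex.ofReal '' Set.Icc (-K + 1) (K - 1) →
        ∀ (N : ℕ) (hN : 1 ≤ N) (T : ℝ), 0 < T →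
          OffDiagSturm.avgOutsideProb (OffDiagSturm.sturmH l₁ l₂ β) N T ≤
            C * (Real.exp (-c * N) +
              T ^ 3 * ∫ E in (-K)..K,
                (OffDiagSturm.maxTransferSq (OffDiagSturm.hop l₁ l₂ β) N hN
                  ((E : ℂ) + Complex.I / (T : ℂ)))⁻¹) := by
  obtain ⟨c, hc, C, hC, hbound⟩ := theorem2_general K (l₁ + l₂) (by linarith)
  exact ⟨c, hc, C, hC, fun β hβ hirr => hbound (OffDiagSturm.hop l₁ l₂ β)
    (OffDiagSturm.abs_hop_le hl₁ hl₂ hβ) (fun n => (OffDiagSturm.hop_pos hl₁ hl₂ hβ n).ne')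
    fun n hn => OffDiagSturm.hop_neg_sub_one l₁ l₂ hirr (by omega) (by omega)⟩
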